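/- Let $n\ge 2$ and let $K\subset\mathbb R^n$ be a symmetric convex body (compact, convex, with non-empty interior, $K=-K$), with support function $h_K(u)=\sup_{y\in K}\langle u,y\rangle$ and surface area measure $S_K$ (the push-forward of the $(n-1)$-dimensional Hausdorff measure on $\partial K$ under the Gauss map $x\mapsto n_x$). Write $|\cdot|_k$ for $k$-dimensional volume, $|\cdot|=|\cdot|_n$, and $K|H$ for the orthogonal projection of $K$ onto a linear subspace $H$. For $k=1,2$ and a compact convex set $M$ put $V_k(K,M)=\frac{(n-k)!}{n!}\frac{d^k}{dt^k}|K+tM|\big|_{t=0^+}$. A zonoid is a non-empty compact set that is a limit, in the Hausdorff metric, of zonotopes, i.e. of finite Minkowski sums of segments $[-v_i,v_i]$. Suppose that for every pair of linearly independent unit vectors $v,w\in\mathbb R^n$, $$4\sqrt{1-\langle v,w\rangle^2}\;\big|K|\mathrm{span}(v,w)^{\perp}\big|_{n-2}+\int_{\mathbb S^{n-1}}\frac{|\langle u,v\rangle|\,|\langle u,w\rangle|}{h_K(u)}\,dS_K(u)\;\le\;\frac{4\,\big|K|v^{\perp}\big|_{n-1}\,\big|K|w^{\perp}\big|_{n-1}}{|K|}.$$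 Then for every zonoid $M$, $$n(n-1)V_2(K,M)+\int_{\mathbb S^{n-1}}\frac{h_M(u)^2}{h_K(u)}\,dS_K(u)\;\le\;\frac{n^2\,V_1(K,M)^2}{|K|}.$$ -/

import Mathlib

open Set Filter Topology MeasureTheory
open scoped Pointwise InnerProductSpace

noncomputable section

namespace LocalLogBM

/-- Euclidean space `ℝⁿ`. -/
abbrev Rn (n : ℕ) : Type := EuclideanSpace ℝ (Fin n)

/-- A symmetric convex body: a compact convex set with non-empty interior and `K = -K`. -/
structure IsSymmConvexBody {n : ℕ} (K : Set (Rn n)) : Prop where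
  convex : Convex ℝ K
  isCompact : IsCompact K
  interior_nonempty : (interior K).Nonempty
  symm : ∀ x ∈ K, -x ∈ K

/-- The support function `h_K(u) = sup_{y ∈ K} ⟨u, y⟩`. -/
def supportFn {n : ℕ} (K : Set (Rn n)) (u : Rn n) : ℝ :=
  sSup ((fun y => ⟪u, y⟫_ℝ) '' K)

/-- `u` is an outer unit normal vector of `K` at the point `x`. -/
def IsOuterUnitNormal {n : ℕ} (K : Set (Rn n)) (x u : Rn n) : Prop :=
  ‖u‖ = 1 ∧ ∀ y ∈ K, ⟪u, y⟫_ℝ ≤ ⟪u, x⟫_ℝ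

/-- The regular boundary points of `K`: those with exactly one outer unit normal.
For a convex body they make up `(n-1)`-almost all of the boundary. -/
def regularBoundary {n : ℕ} (K : Set (Rn n)) : Set (Rn n) :=
  {x | x ∈ frontier K ∧ ∃! u, IsOuterUnitNormal K x u}

open Classical in
/-- The Gauss map `x ↦ n_x`, which sends a regular boundary point to its outer unit normal
(and takes the irrelevant value `0` elsewhere). -/
def gaussMap {n : ℕ} (K : Set (Rn n)) (x : Rn n) : Rn n :=
  if h : x ∈ regularBoundary K then h.2.choose else 0

/-- The surface area measure `S_K`: the push-forward, under the Gauss map, of the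
`(n-1)`-dimensional Hausdorff measure (normalised to agree with Lebesgue measure) on the regular
part of the boundary of `K`. It is a measure on `ℝⁿ` concentrated on the unit sphere. -/
def surfaceAreaMeasure {n : ℕ} (K : Set (Rn n)) : Measure (Rn n) :=
  Measure.map (gaussMap K) ((μHE[n - 1] : Measure (Rn n)).restrict (regularBoundary K))

/-- The orthogonal projection `K|H = {x ∈ H : ∃ y ∈ H^⊥, x + y ∈ K}`. -/
def projSet {n : ℕ} (K : Set (Rn n)) (H : Submodule ℝ (Rn n)) : Set (Rn n) :=
  {x | x ∈ H ∧ ∃ y ∈ Hᗮ, x + y ∈ K}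

/-- The `k`-dimensional volume of the orthogonal projection `K|H`. -/
def projVol {n : ℕ} (k : ℕ) (K : Set (Rn n)) (H : Submodule ℝ (Rn n)) : ℝ :=
  (μHE[k] : Measure (Rn n)).real (projSet K H)

/-- The mixed volume `V_k(K, M) = ((n-k)!/n!) · (d/dt)^k |K + tM|` at `t = 0`, where the
derivative is one-sided (`t ≥ 0`). -/
def mixedVol {n : ℕ} (k : ℕ) (K M : Set (Rn n)) : ℝ :=
  ((n - k).factorial : ℝ) / (n.factorial : ℝ) *
    iteratedDerivWithin k (fun t : ℝ => volume.real (K + t • M)) (Ici 0) 0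

/-- A zonotope: a finite Minkowski sum of segments `[-v_i, v_i]`. -/
def IsZonotope {n : ℕ} (Z : Set (Rn n)) : Prop :=
  ∃ (N : ℕ) (v : Fin N → Rn n), Z = ∑ i, segment ℝ (-(v i)) (v i)

/-- A zonoid: a non-empty compact set that is a limit of zonotopes in the Hausdorff metric
(such a set is automatically convex and symmetric). -/
def IsZonoid {n : ℕ} (M : Set (Rn n)) : Prop :=
  IsCompact M ∧ M.Nonempty ∧
    ∃ Z : ℕ → Set (Rn n), (∀ k, IsZonotope (Z k)) ∧
      Tendsto (fun k => Metric.hausdorffDist (Z k) M) atTop (𝓝 0)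

theorem isCompact_normalPairs {n : ℕ} {K : Set (Rn n)} (hK : IsCompact K) :
    IsCompact {p : Rn n × Rn n | p.1 ∈ frontier K ∧ IsOuterUnitNormal K p.1 p.2} := by
  have h1 : IsCompact (frontier K) :=
    hK.of_isClosed_subset isClosed_frontier hK.isClosed.frontier_subset
  refine (h1.prod (isCompact_sphere (0 : Rn n) 1)).of_isClosed_subset ?_ ?_
  · have : {p : Rn n × Rn n | p.1 ∈ frontier K ∧ IsOuterUnitNormal K p.1 p.2} =
        {p | p.1 ∈ frontier K} ∩ ({p | ‖p.2‖ = 1} ∩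
          ⋂ y ∈ K, {p : Rn n × Rn n | ⟪p.2, y⟫_ℝ ≤ ⟪p.2, p.1⟫_ℝ}) := by
      ext p; simp [IsOuterUnitNormal]
    rw [this]
    refine (isClosed_frontier.preimage continuous_fst).inter
      ((isClosed_eq (by fun_prop) (by fun_prop)).inter ?_)
    exact isClosed_biInter fun y _ => isClosed_le (by fun_prop) (by fun_prop)
  · rintro p ⟨hp, hu, -⟩
    exact ⟨hp, by simpa using hu⟩

theorem measurableSet_regularBoundary {n : ℕ} {K : Set (Rn n)} (hK : IsCompact K) :
    MeasurableSet (regularBoundary K) := by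
  have hN := isCompact_normalPairs hK
  set N := {p : Rn n × Rn n | p.1 ∈ frontier K ∧ IsOuterUnitNormal K p.1 p.2} with hNdef
  let T : ℕ → Set ((Rn n × Rn n) × (Rn n × Rn n)) := fun k =>
    (N ×ˢ N) ∩ {q | q.1.1 = q.2.1 ∧ 1 / ((k : ℝ) + 1) ≤ dist q.1.2 q.2.2}
  have hT : ∀ k, IsCompact (T k) := fun k => (hN.prod hN).inter_right
    ((isClosed_eq (continuous_fst.comp continuous_fst) (continuous_fst.comp continuous_snd)).inter
      (isClosed_le continuous_const
        ((continuous_snd.comp continuous_fst).dist (continuous_snd.comp continuous_snd))))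
  have : regularBoundary K =
      (Prod.fst '' N) \ ⋃ k, (fun q : (Rn n × Rn n) × (Rn n × Rn n) => q.1.1) '' (T k) := by
    ext x
    constructor
    · rintro ⟨hx, u, hu, huu⟩
      refine ⟨⟨(x, u), ⟨hx, hu⟩, rfl⟩, ?_⟩
      simp only [mem_iUnion, not_exists]
      rintro k ⟨⟨⟨a, b⟩, ⟨c, d⟩⟩, ⟨⟨h1, h2⟩, h3, h4⟩, rfl⟩
      obtain rfl : a = c := h3
      have hb : b = u := huu _ h1.2
      have hd : d = u := huu _ h2.2
      subst hb; subst hd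
      simp only [dist_self] at h4
      have : (0 : ℝ) < 1 / ((k : ℝ) + 1) := by positivity
      linarith
    · rintro ⟨⟨⟨a, u⟩, ⟨ha, hu⟩, rfl⟩, hx⟩
      refine ⟨ha, u, hu, fun u' hu' => ?_⟩
      by_contra hne
      obtain ⟨k, hk⟩ := exists_nat_one_div_lt (dist_pos.2 hne)
      exact hx (mem_iUnion.2 ⟨k, ((a, u'), (a, u)), ⟨⟨⟨ha, hu'⟩, ⟨ha, hu⟩⟩, rfl, hk.le⟩, rfl⟩)
  rw [this]
  refine (hN.image continuous_fst).measurableSet.diff (MeasurableSet.iUnion fun k => ?_)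
  exact ((hT k).image (by fun_prop)).measurableSet

/-- The Gauss map is measurable, so that the push-forward defining `S_K` is a genuine one. -/
theorem measurable_gaussMap {n : ℕ} {K : Set (Rn n)} (hK : IsCompact K) :
    Measurable (gaussMap K) := by
  have hR := measurableSet_regularBoundary hK
  have hN := isCompact_normalPairs hK
  refine measurable_of_isClosed fun C hC => ?_
  have key : gaussMap K ⁻¹' C =
      (regularBoundary K ∩ Prod.fst '' ({p : Rn n × Rn n | p.1 ∈ frontier K ∧
        IsOuterUnitNormal K p.1 p.2} ∩ Prod.snd ⁻¹' C)) ∪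
      ((regularBoundary K)ᶜ ∩ {_x | (0 : Rn n) ∈ C}) := by
    ext x
    by_cases hx : x ∈ regularBoundary K
    · have hs := hx.2.choose_spec
      simp only [mem_preimage, gaussMap, hx, dif_pos, mem_union, mem_inter_iff, true_and,
        mem_compl_iff, not_true_eq_false, false_and, or_false]
      constructor
      · intro h
        exact ⟨(x, hx.2.choose), ⟨⟨hx.1, hs.1⟩, h⟩, rfl⟩
      · rintro ⟨⟨a, u⟩, ⟨⟨_, hu⟩, huC⟩, rfl⟩
        rw [← hs.2 u hu]; exact huC
    · simp [gaussMap, hx]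
  rw [key]
  refine (hR.inter ?_).union (hR.compl.inter (MeasurableSet.const _))
  exact ((hN.inter_right (hC.preimage continuous_snd)).image continuous_fst).measurableSet

end LocalLogBM

end

/-!
Adding one segment `[-v, v]` to a convex body lengthens every nonempty line section in direction
`v` by `2‖v‖`, so by Fubini the volume grows by `2‖v‖` times the volume of the projection along `v`.
Adding the generators of a zonotope `Z` one at a time, `|K + tZ|` is therefore a polynomial in `t`;
its linear coefficient is a sum over generators and its quadratic coefficient a sum over pairs of
generators. So `V₁(K, Z)` is linear, and both `V₂(K, Z)` and `∫ h_Z² / h_K dS_K` are quadratic, in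
the segments of `Z`, and the hypothesis is the inequality for a single pair of segments. It passes
to dependent pairs by continuity; summing over all pairs proves the case of zonotopes. Finally,
Hausdorff convergence of zonotopes gives convergence of the volumes `|K + tZ|` for each `t`, hence
of the coefficients of these polynomials, which have degree at most `n`.
-/

namespace LocalLogBM

section Segments

variable {F G : Type*} [AddCommGroup F] [Module ℝ F] [AddCommGroup G] [Module ℝ G]

/-- The symmetric segment `[-v, v]`. -/
abbrev symmSegment (v : F) : Set F := segment ℝ (-v) v

theorem image_symmSegment (f : F →ₗ[ℝ] G) (v : F) : f '' symmSegment v = symmSegment (f v) := by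
  simpa using image_segment ℝ f.toAffineMap (-v) v

theorem smul_symmSegment (t : ℝ) (v : F) : t • symmSegment v = symmSegment (t • v) :=
  image_symmSegment (LinearMap.lsmul ℝ F t) v

theorem symmSegment_smul_eq_image {t : ℝ} (ht : 0 ≤ t) (v : F) :
    symmSegment (t • v) = (fun s : ℝ => s • v) '' Icc (-t) t := by
  rw [← segment_eq_Icc (neg_le_self ht)]
  exact (image_symmSegment (LinearMap.toSpanSingleton ℝ F v) t).symm

theorem symmSegment_eq_image (v : F) : symmSegment v = (fun s : ℝ => s • v) '' Icc (-1) 1 := by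
  simpa using symmSegment_smul_eq_image zero_le_one v

theorem zero_mem_symmSegment (v : F) : (0 : F) ∈ symmSegment v := by
  rw [symmSegment_eq_image]
  exact ⟨0, by simp, zero_smul ℝ v⟩

theorem isCompact_symmSegment [TopologicalSpace F] [ContinuousSMul ℝ F] (v : F) :
    IsCompact (symmSegment v) := by
  rw [symmSegment_eq_image]
  exact isCompact_Icc.image (by fun_prop)

end Segments

section HyperplaneProjection

variable {E : Type*} [NormedAddCommGroup E] [InnerProductSpace ℝ E]

/-- The orthogonal projection onto the hyperplane `v^⊥`, with values in that hyperplane. -/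
noncomputable abbrev hyperProj (v : E) : E →L[ℝ] (ℝ ∙ v)ᗮ := (ℝ ∙ v)ᗮ.orthogonalProjectionOnto

theorem hyperProj_smul_add {e : E} (s : ℝ) (y : (ℝ ∙ e)ᗮ) :
    hyperProj e (s • e + (y : E)) = y := by
  have he : hyperProj e e = 0 := by
    rw [Submodule.orthogonalProjectionOnto_eq_zero_iff, Submodule.orthogonal_orthogonal]
    exact Submodule.mem_span_singleton_self e
  rw [map_add, map_smul, he, smul_zero, zero_add,
    Submodule.orthogonalProjectionOnto_mem_subspace_eq_self]

theorem exists_eq_smul_add_hyperProj (e x : E) :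
    ∃ s : ℝ, x = s • e + (hyperProj e x : E) := by
  have hx := (ℝ ∙ e)ᗮ.sub_starProjection_mem_orthogonal x
  rw [Submodule.orthogonal_orthogonal, Submodule.mem_span_singleton] at hx
  obtain ⟨s, hs⟩ := hx
  exact ⟨s, by rw [hs, Submodule.starProjection_apply, sub_add_cancel]⟩

theorem finrank_orthogonal_span_singleton_add_one [FiniteDimensional ℝ E] {v : E} (hv : v ≠ 0) :
    Module.finrank ℝ (ℝ ∙ v)ᗮ + 1 = Module.finrank ℝ E := by
  rw [← (ℝ ∙ v).finrank_add_finrank_orthogonal, finrank_span_singleton hv, add_comm]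

end HyperplaneProjection

section LineSections

variable {E : Type*} [NormedAddCommGroup E] [InnerProductSpace ℝ E]

/-- The section of `S` by the line through `y` in direction `e`, read off in the parameter of
that line. -/
def lineSection (S : Set E) (e y : E) : Set ℝ := {s | s • e + y ∈ S}

theorem convex_lineSection {S : Set E} (hS : Convex ℝ S) (e y : E) :
    Convex ℝ (lineSection S e y) :=
  (hS.translate_preimage_left y).linear_preimage (LinearMap.toSpanSingleton ℝ E e)

theorem isCompact_lineSection {S : Set E} (hS : IsCompact S) {e : E} (he : ‖e‖ = 1) (y : E) :
    IsCompact (lineSection S e y) := by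
  have hline : Isometry fun s : ℝ => s • e + y := Isometry.of_dist_eq fun a b => by
    rw [dist_add_right, dist_eq_norm, ← sub_smul, norm_smul, he, mul_one, dist_eq_norm]
  exact hline.isClosedEmbedding.isCompact_preimage hS

theorem lineSection_nonempty_iff {S : Set E} {e : E} {y : (ℝ ∙ e)ᗮ} :
    (lineSection S e y).Nonempty ↔ y ∈ hyperProj e '' S := by
  constructor
  · rintro ⟨s, hs⟩
    exact ⟨_, hs, hyperProj_smul_add s y⟩
  · rintro ⟨x, hx, rfl⟩
    obtain ⟨s, hs⟩ := exists_eq_smul_add_hyperProj e x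
    exact ⟨s, by rwa [lineSection, mem_ofPred_eq, ← hs]⟩

theorem lineSection_add_symmSegment (S : Set E) (e y : E) {t : ℝ} (ht : 0 ≤ t) :
    lineSection (S + symmSegment (t • e)) e y = lineSection S e y + Icc (-t) t := by
  rw [symmSegment_smul_eq_image ht]
  ext s
  constructor
  · rintro ⟨x, hx, _, ⟨r, hr, rfl⟩, hxr⟩
    refine ⟨s - r, ?_, r, hr, sub_add_cancel s r⟩
    rwa [lineSection, mem_ofPred_eq, sub_smul, sub_add_eq_add_sub, ← hxr, add_sub_cancel_right]
  · rintro ⟨a, ha, b, hb, rfl⟩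
    exact ⟨_, ha, _, ⟨b, hb, rfl⟩, by module⟩

theorem volume_add_Icc {I : Set ℝ} (hI : IsCompact I) (hc : Convex ℝ I) (hne : I.Nonempty)
    {t : ℝ} (ht : 0 ≤ t) :
    volume (I + Icc (-t) t) = volume I + ENNReal.ofReal (2 * t) := by
  have hle : sInf I ≤ sSup I := csInf_le_csSup hne hI.bddBelow hI.bddAbove
  rw [eq_Icc_of_connected_compact ⟨hne, hc.isPreconnected⟩ hI, Icc_add_Icc hle (neg_le_self ht),
    Real.volume_Icc, Real.volume_Icc, ← ENNReal.ofReal_add (sub_nonneg.2 hle) (by positivity)]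
  ring_nf

end LineSections

section SegmentVolume

variable {E : Type*} [NormedAddCommGroup E] [InnerProductSpace ℝ E] [FiniteDimensional ℝ E]
  [MeasurableSpace E] [BorelSpace E]

theorem measurePreserving_smul_add {e : E} (he : ‖e‖ = 1) :
    MeasurePreserving (fun p : ℝ × (ℝ ∙ e)ᗮ => p.1 • e + (p.2 : E)) := by
  have hline : MeasurePreserving (Prod.map (LinearIsometryEquiv.toSpanUnitSingleton (𝕜 := ℝ) e he)
      (id : (ℝ ∙ e)ᗮ → (ℝ ∙ e)ᗮ)) :=
    (LinearIsometryEquiv.measurePreserving _).prod (MeasurePreserving.id volume)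
  have hsplit := ((ℝ ∙ e).measurePreserving_measurableEquivProd (0 : E)).symm
  rw [InnerProductSpace.euclideanHausdorffMeasure_eq_volume] at hsplit
  convert hsplit.comp hline using 1
  ext p
  simp [Submodule.measurableEquivProd_symm_apply]

theorem volume_eq_lintegral_lineSection {e : E} (he : ‖e‖ = 1) {S : Set E}
    (hS : MeasurableSet S) :
    volume S = ∫⁻ y : (ℝ ∙ e)ᗮ, volume (lineSection S e y) := by
  have hmp := measurePreserving_smul_add he
  rw [← hmp.measure_preimage hS.nullMeasurableSet]
  exact Measure.prod_apply_symm (hmp.measurable hS)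

theorem volume_add_symmSegment_unit {e : E} (he : ‖e‖ = 1) {L : Set E} (hL : IsCompact L)
    (hc : Convex ℝ L) {t : ℝ} (ht : 0 ≤ t) :
    volume (L + symmSegment (t • e)) =
      volume L + ENNReal.ofReal (2 * t) * volume (hyperProj e '' L) := by
  have himg : MeasurableSet (hyperProj e '' L) := (hL.image (hyperProj e).continuous).measurableSet
  rw [volume_eq_lintegral_lineSection he (hL.add (isCompact_symmSegment _)).measurableSet,
    volume_eq_lintegral_lineSection he hL.measurableSet, ← lintegral_indicator_const himg,
    ← lintegral_add_right _ (measurable_const.indicator himg)]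
  refine lintegral_congr fun y => ?_
  rw [lineSection_add_symmSegment L e y ht]
  by_cases hy : y ∈ hyperProj e '' L
  · rw [indicator_of_mem hy]
    exact volume_add_Icc (isCompact_lineSection hL he y) (convex_lineSection hc e y)
      (lineSection_nonempty_iff.2 hy) ht
  · rw [indicator_of_notMem hy, not_nonempty_iff_eq_empty.1 (mt lineSection_nonempty_iff.1 hy)]
    simp

/-- The volume of the projection of `L` along `v`, scaled by the length `2‖v‖` of `[-v, v]`: the
growth rate in `t` of the volume of `L + t[-v, v]`. -/
noncomputable def segmentRate (L : Set E) (v : E) : ℝ :=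
  2 * ‖v‖ * volume.real (hyperProj v '' L)

theorem segmentRate_zero_right (L : Set E) : segmentRate L 0 = 0 := by
  simp [segmentRate]

theorem segmentRate_nonneg (L : Set E) (v : E) : 0 ≤ segmentRate L v := by
  unfold segmentRate
  positivity

theorem segmentRate_smul (L : Set E) (a : ℝ) (v : E) :
    segmentRate L (a • v) = |a| * segmentRate L v := by
  rcases eq_or_ne a 0 with rfl | ha
  · rw [zero_smul, segmentRate_zero_right, abs_zero, zero_mul]
  have hproj : volume.real (hyperProj (a • v) '' L) = volume.real (hyperProj v '' L) :=
    congrArg (fun W : Submodule ℝ E => volume.real (Wᗮ.orthogonalProjectionOnto '' L))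
      (Submodule.span_singleton_smul_eq ha.isUnit v)
  rw [segmentRate, segmentRate, hproj, norm_smul, Real.norm_eq_abs]
  ring

theorem volume_add_symmSegment {L : Set E} (hL : IsCompact L) (hc : Convex ℝ L) (v : E) :
    volume.real (L + symmSegment v) = volume.real L + segmentRate L v := by
  rcases eq_or_ne v 0 with rfl | hv
  · simp [segmentRate_zero_right, symmSegment]
  set e : E := ‖v‖⁻¹ • v
  have he : ‖e‖ = 1 := norm_smul_inv_norm hv
  have hve : v = ‖v‖ • e := (smul_inv_smul₀ (norm_ne_zero_iff.2 hv) v).symm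
  have hproj : volume (hyperProj e '' L) ≠ ⊤ :=
    (hL.image (hyperProj e).continuous).measure_ne_top
  rw [hve, segmentRate_smul, measureReal_def,
    volume_add_symmSegment_unit he hL hc (norm_nonneg v),
    ENNReal.toReal_add hL.measure_ne_top (ENNReal.mul_ne_top ENNReal.ofReal_ne_top hproj),
    ENNReal.toReal_mul, ENNReal.toReal_ofReal (by positivity), abs_norm, segmentRate, he]
  simp only [measureReal_def]
  ring

theorem volume_add_smul_symmSegment {L : Set E} (hL : IsCompact L) (hc : Convex ℝ L) (v : E)
    {t : ℝ} (ht : 0 ≤ t) :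
    volume.real (L + t • symmSegment v) = volume.real L + t * segmentRate L v := by
  rw [smul_symmSegment, volume_add_symmSegment hL hc, segmentRate_smul, abs_of_nonneg ht]

end SegmentVolume

section Zonotope

variable {F G : Type*} [AddCommGroup F] [Module ℝ F] [AddCommGroup G] [Module ℝ G]

/-- The zonotope `∑ [-vᵢ, vᵢ]`. The generators form a list, so that statements about zonotopes can
be proved by adding one segment at a time. -/
def zonotope (l : List F) : Set F := (l.map symmSegment).sum

@[simp]
theorem zonotope_nil : zonotope ([] : List F) = {0} := rfl

theorem zonotope_cons (v : F) (l : List F) :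
    zonotope (v :: l) = symmSegment v + zonotope l :=
  List.sum_cons

theorem convex_zonotope (l : List F) : Convex ℝ (zonotope l) := by
  induction l with
  | nil => exact convex_singleton 0
  | cons v l ih => exact zonotope_cons v l ▸ (convex_segment _ _).add ih

theorem zero_mem_zonotope (l : List F) : (0 : F) ∈ zonotope l := by
  induction l with
  | nil => exact mem_singleton 0
  | cons v l ih => exact zonotope_cons v l ▸ ⟨0, zero_mem_symmSegment v, 0, ih, add_zero 0⟩

theorem isCompact_zonotope [TopologicalSpace F] [ContinuousAdd F] [ContinuousSMul ℝ F]
    (l : List F) : IsCompact (zonotope l) := by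
  induction l with
  | nil => exact isCompact_singleton
  | cons v l ih => exact zonotope_cons v l ▸ (isCompact_symmSegment v).add ih

theorem image_zonotope (f : F →ₗ[ℝ] G) (l : List F) : f '' zonotope l = zonotope (l.map f) := by
  induction l with
  | nil => simp
  | cons v l ih =>
    rw [zonotope_cons, image_add, ih, image_symmSegment, List.map_cons, zonotope_cons]

end Zonotope

section ZonotopeVolume

open Polynomial

variable {E : Type*} [NormedAddCommGroup E] [InnerProductSpace ℝ E] [FiniteDimensional ℝ E]
  [MeasurableSpace E] [BorelSpace E]

/-- The growth rate in `s` and `t` of the mixed term of the volume of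
`L + s[-v, v] + t[-w, w]`: the rate of `[-w, w]` after projecting along `v`. -/
noncomputable def segmentRate₂ (L : Set E) (v w : E) : ℝ :=
  2 * ‖v‖ * segmentRate (hyperProj v '' L) (hyperProj v w)

theorem segmentRate₂_smul_left (L : Set E) (a : ℝ) (v w : E) :
    segmentRate₂ L (a • v) w = |a| * segmentRate₂ L v w := by
  rcases eq_or_ne a 0 with rfl | ha
  · simp [segmentRate₂]
  have hproj : segmentRate (hyperProj (a • v) '' L) (hyperProj (a • v) w) =
      segmentRate (hyperProj v '' L) (hyperProj v w) :=
    congrArg (fun W : Submodule ℝ E => segmentRate (Wᗮ.orthogonalProjectionOnto '' L)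
      (Wᗮ.orthogonalProjectionOnto w)) (Submodule.span_singleton_smul_eq ha.isUnit v)
  rw [segmentRate₂, segmentRate₂, hproj, norm_smul, Real.norm_eq_abs]
  ring

theorem segmentRate₂_smul_right (L : Set E) (v : E) (a : ℝ) (w : E) :
    segmentRate₂ L v (a • w) = |a| * segmentRate₂ L v w := by
  rw [segmentRate₂, map_smul, segmentRate_smul, segmentRate₂]
  ring

/-- The sum of the mixed rates over all pairs of generators: the quadratic coefficient of the
volume of `L + t • zonotope l`. -/
noncomputable def pairRate (L : Set E) : List E → ℝ
  | [] => 0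
  | v :: l => pairRate L l + (l.map (segmentRate₂ L v)).sum

theorem volume_add_smul_zonotope_cons (v : E) (l : List E) {L : Set E} (hL : IsCompact L)
    (hc : Convex ℝ L) {t : ℝ} (ht : 0 ≤ t) :
    volume.real (L + t • zonotope (v :: l)) = volume.real (L + t • zonotope l) +
      t * (2 * ‖v‖ * volume.real (hyperProj v '' L + t • zonotope (l.map (hyperProj v)))) := by
  have hproj : hyperProj v '' (L + t • zonotope l) =
      hyperProj v '' L + t • zonotope (l.map (hyperProj v)) := by
    rw [image_add, image_smul_set]
    exact congrArg (_ + t • ·) (image_zonotope (hyperProj v).toLinearMap l)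
  rw [zonotope_cons, smul_add, add_comm (t • symmSegment v), ← add_assoc,
    volume_add_smul_symmSegment (hL.add ((isCompact_zonotope l).smul t))
      (hc.add ((convex_zonotope l).smul t)) v ht, segmentRate, hproj]

/-- The first three coefficients come from Fubini along one generator `v` at a time: adding `v`
contributes `2‖v‖ t` times the volume polynomial of the projections along `v`. -/
theorem exists_polynomial_volume_add_zonotope (l : List E) {L : Set E} (hL : IsCompact L)
    (hc : Convex ℝ L) :
    ∃ p : ℝ[X], p.natDegree ≤ Module.finrank ℝ E ∧
      (∀ t : ℝ, 0 ≤ t → volume.real (L + t • zonotope l) = p.eval t) ∧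
      p.coeff 0 = volume.real L ∧ p.coeff 1 = (l.map (segmentRate L)).sum ∧
      p.coeff 2 = pairRate L l := by
  induction hl : l.length generalizing E with
  | zero =>
    obtain rfl := List.length_eq_zero_iff.1 hl
    exact ⟨C (volume.real L), by simp, by simp, by simp, by simp, by simp [pairRate]⟩
  | succ N ih =>
    obtain ⟨v, l, rfl⟩ := List.exists_cons_of_length_eq_add_one hl
    have hN : l.length = N := by simpa using hl
    obtain ⟨p, hpd, hp, hp0, hp1, hp2⟩ := ih l hL hc hN
    obtain ⟨q, hqd, hq, hq0, hq1, -⟩ := ih (l.map (hyperProj v))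
      (hL.image (hyperProj v).continuous) (hc.linear_image (hyperProj v).toLinearMap)
      (by simpa using hN)
    refine ⟨p + X * (C (2 * ‖v‖) * q), ?_, fun t ht => ?_, by simp [hp0], ?_, ?_⟩
    · refine (natDegree_add_le _ _).trans (max_le hpd ?_)
      rcases eq_or_ne v 0 with rfl | hv
      · simp
      · rw [← finrank_orthogonal_span_singleton_add_one hv, add_comm]
        refine natDegree_mul_le.trans (add_le_add natDegree_X_le ?_)
        exact (natDegree_C_mul_le _ q).trans hqd
    · rw [volume_add_smul_zonotope_cons v l hL hc ht, hp t ht, hq t ht]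
      simp
    · rw [coeff_add, coeff_X_mul _ 0, coeff_C_mul, hq0, hp1, List.map_cons, List.sum_cons,
        segmentRate, add_comm]
    · rw [coeff_add, coeff_X_mul _ 1, coeff_C_mul, hq1, hp2, pairRate, List.map_map,
        ← List.sum_map_mul_left]
      rfl

end ZonotopeVolume

section Polynomials

open Polynomial

/-- Lagrange interpolation at `d + 1` nodes of `S` writes both the values and the coefficients of a
polynomial of degree at most `d` as fixed linear combinations of its values on `S`. -/
theorem exists_polynomial_of_tendsto_eval {ι 𝕜 : Type*} [Field 𝕜] [TopologicalSpace 𝕜]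
    [IsTopologicalRing 𝕜] [T2Space 𝕜] {l : Filter ι} [l.NeBot] {S : Set 𝕜} (hS : S.Infinite)
    {d : ℕ} {p : ι → 𝕜[X]} (hd : ∀ i, (p i).natDegree ≤ d) {f : 𝕜 → 𝕜}
    (hf : ∀ t ∈ S, Tendsto (fun i => (p i).eval t) l (𝓝 (f t))) :
    ∃ q : 𝕜[X], (∀ t ∈ S, f t = q.eval t) ∧
      ∀ j, Tendsto (fun i => (p i).coeff j) l (𝓝 (q.coeff j)) := by
  classical
  obtain ⟨s, hsS, hs⟩ := hS.exists_subset_card_eq (d + 1)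
  have hp (i) : p i = Lagrange.interpolate s id fun a => (p i).eval a :=
    Lagrange.eq_interpolate (injOn_id _) (degree_le_natDegree.trans_lt
      (by rw [hs]; exact_mod_cast Nat.lt_succ_of_le (hd i)))
  have hlim (φ : 𝕜[X] →ₗ[𝕜] 𝕜) :
      Tendsto (fun i => φ (p i)) l (𝓝 (φ (Lagrange.interpolate s id f))) := by
    have hφ (r : 𝕜 → 𝕜) : φ (Lagrange.interpolate s id r) =
        ∑ a ∈ s, r a * φ (Lagrange.basis s id a) := by
      simp only [Lagrange.interpolate_apply, map_sum, ← smul_eq_C_mul, map_smul, smul_eq_mul]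
    rw [hφ f]
    simp_rw [fun i => (congrArg φ (hp i)).trans (hφ _)]
    exact tendsto_finsetSum _ fun a ha => (hf a (hsS ha)).mul_const _
  exact ⟨Lagrange.interpolate s id f,
    fun t ht => tendsto_nhds_unique (hf t ht) (hlim (Polynomial.leval t)),
    fun j => hlim (Polynomial.lcoeff 𝕜 j)⟩

theorem iteratedDeriv_eval_zero {𝕜 : Type*} [NontriviallyNormedField 𝕜] (q : 𝕜[X]) (k : ℕ) :
    iteratedDeriv k (fun t => q.eval t) 0 = k.factorial * q.coeff k := by
  have hderiv : deriv^[k] (fun t => q.eval t) = fun t => (derivative^[k] q).eval t := by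
    induction k with
    | zero => rfl
    | succ k ih =>
      rw [Function.iterate_succ_apply', Function.iterate_succ_apply', ih]
      exact funext fun t => Polynomial.deriv _
  rw [iteratedDeriv_eq_iterate, hderiv]
  simp only [← coeff_zero_eq_eval_zero, coeff_iterate_derivative, zero_add, Nat.descFactorial_self,
    nsmul_eq_mul]

end Polynomials

section MixedVolume

open Polynomial

variable {n : ℕ} {K M : Set (Rn n)}

theorem mixedVol_eq_coeff {q : ℝ[X]}
    (hq : ∀ t : ℝ, 0 ≤ t → volume.real (K + t • M) = q.eval t) (k : ℕ) :
    mixedVol k K M = (n - k).factorial / n.factorial * (k.factorial * q.coeff k) := by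
  have hsmooth : ContDiff ℝ k fun t : ℝ => q.eval t := by
    simpa only [coe_aeval_eq_eval] using q.contDiff_aeval (𝕜 := ℝ) k
  rw [mixedVol, iteratedDerivWithin_congr (s := Ici 0) (fun t ht => hq t ht) self_mem_Ici,
    iteratedDerivWithin_eq_iteratedDeriv (uniqueDiffOn_Ici 0) hsmooth.contDiffAt self_mem_Ici,
    iteratedDeriv_eval_zero]

theorem descFactorial_mul_mixedVol {q : ℝ[X]}
    (hq : ∀ t : ℝ, 0 ≤ t → volume.real (K + t • M) = q.eval t) {k : ℕ} (hk : k ≤ n) :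
    n.descFactorial k * mixedVol k K M = k.factorial * q.coeff k := by
  have hn : ((n - k).factorial : ℝ) * n.descFactorial k = n.factorial :=
    mod_cast Nat.factorial_mul_descFactorial hk
  rw [mixedVol_eq_coeff hq, ← mul_assoc, mul_div_assoc', mul_comm (n.descFactorial k : ℝ), hn,
    div_self (Nat.cast_ne_zero.2 n.factorial_ne_zero), one_mul]

variable (hKc : IsCompact K) (hK : Convex ℝ K)
include hKc hK

theorem mul_mixedVol_one_zonotope (hn : 1 ≤ n) (l : List (Rn n)) :
    n * mixedVol 1 K (zonotope l) = (l.map (segmentRate K)).sum := by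
  obtain ⟨p, -, hp, -, hp1, -⟩ := exists_polynomial_volume_add_zonotope l hKc hK
  simpa [hp1] using descFactorial_mul_mixedVol hp hn

theorem mul_mixedVol_two_zonotope (hn : 2 ≤ n) (l : List (Rn n)) :
    n * (n - 1) * mixedVol 2 K (zonotope l) = 2 * pairRate K l := by
  obtain ⟨p, -, hp, -, -, hp2⟩ := exists_polynomial_volume_add_zonotope l hKc hK
  rw [← Nat.cast_descFactorial_two, descFactorial_mul_mixedVol hp hn, hp2, Nat.factorial_two,
    Nat.cast_two]

theorem tendsto_mixedVol_of_tendsto_volume {ι : Type*} {f : Filter ι} [f.NeBot]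
    {l : ι → List (Rn n)}
    (h : ∀ t : ℝ, 0 ≤ t → Tendsto (fun i => volume.real (K + t • zonotope (l i))) f
      (𝓝 (volume.real (K + t • M)))) (k : ℕ) :
    Tendsto (fun i => mixedVol k K (zonotope (l i))) f (𝓝 (mixedVol k K M)) := by
  choose p hpd hp _ using fun i => exists_polynomial_volume_add_zonotope (l i) hKc hK
  obtain ⟨q, hq, hcoeff⟩ := exists_polynomial_of_tendsto_eval (Ici_infinite (0 : ℝ)) hpd
    fun t ht => (h t ht).congr fun i => hp i t ht
  simp_rw [fun i => mixedVol_eq_coeff (hp i) k, mixedVol_eq_coeff hq k]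
  exact ((hcoeff k).const_mul _).const_mul _

end MixedVolume

section HausdorffLimits

variable {X ι : Type*} [PseudoMetricSpace X] {f : Filter ι}

theorem exists_dist_le_hausdorffDist {A B : Set X} (hA : Bornology.IsBounded A) (hB : IsCompact B)
    (hB0 : B.Nonempty) {a : X} (ha : a ∈ A) : ∃ b ∈ B, dist a b ≤ Metric.hausdorffDist A B := by
  obtain ⟨b, hb, hab⟩ := hB.exists_infDist_eq_dist hB0 a
  exact ⟨b, hb, hab ▸ Metric.infDist_le_hausdorffDist_of_mem ha
    (Metric.hausdorffEDist_ne_top_of_nonempty_of_bounded ⟨a, ha⟩ hB0 hA hB.isBounded)⟩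

theorem exists_tendsto_of_tendsto_hausdorffDist {A : ι → Set X} {B : Set X}
    (hA : ∀ i, IsCompact (A i)) (hA0 : ∀ i, (A i).Nonempty) (hB : Bornology.IsBounded B)
    (h : Tendsto (fun i => Metric.hausdorffDist (A i) B) f (𝓝 0)) {x : X} (hx : x ∈ B) :
    ∃ a : ι → X, (∀ i, a i ∈ A i) ∧ Tendsto a f (𝓝 x) := by
  choose a ha hxa using fun i => exists_dist_le_hausdorffDist hB (hA i) (hA0 i) hx
  simp_rw [dist_comm x, Metric.hausdorffDist_comm (s := B)] at hxa
  exact ⟨a, ha, tendsto_iff_dist_tendsto_zero.2 (squeeze_zero (fun _ => dist_nonneg) hxa h)⟩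

theorem mem_of_tendsto_hausdorffDist [f.NeBot] {A : ι → Set X} {B : Set X}
    (hA : ∀ i, Bornology.IsBounded (A i)) (hB : IsClosed B)
    (hBb : Bornology.IsBounded B) (hB0 : B.Nonempty)
    (h : Tendsto (fun i => Metric.hausdorffDist (A i) B) f (𝓝 0)) {a : ι → X}
    (ha : ∀ i, a i ∈ A i) {x : X} (hx : Tendsto a f (𝓝 x)) : x ∈ B := by
  have hdist (i) : Metric.infDist (a i) B ≤ Metric.hausdorffDist (A i) B :=
    Metric.infDist_le_hausdorffDist_of_mem (ha i)
      (Metric.hausdorffEDist_ne_top_of_nonempty_of_bounded ⟨a i, ha i⟩ hB0 (hA i) hBb)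
  rw [hB.mem_iff_infDist_zero hB0]
  exact tendsto_nhds_unique ((Metric.continuous_infDist_pt B).tendsto x |>.comp hx)
    (squeeze_zero (fun _ => Metric.infDist_nonneg) hdist h)

end HausdorffLimits

section HausdorffNormed

variable {E ι : Type*} [NormedAddCommGroup E] [NormedSpace ℝ E] {f : Filter ι}

theorem convex_of_tendsto_hausdorffDist [f.NeBot] {A : ι → Set E} {B : Set E}
    (hA : ∀ i, IsCompact (A i)) (hA0 : ∀ i, (A i).Nonempty) (hAc : ∀ i, Convex ℝ (A i))
    (hB : IsClosed B) (hBb : Bornology.IsBounded B)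
    (h : Tendsto (fun i => Metric.hausdorffDist (A i) B) f (𝓝 0)) : Convex ℝ B := by
  intro x hx y hy s t hs ht hst
  obtain ⟨a, ha, hax⟩ := exists_tendsto_of_tendsto_hausdorffDist hA hA0 hBb h hx
  obtain ⟨b, hb, hby⟩ := exists_tendsto_of_tendsto_hausdorffDist hA hA0 hBb h hy
  exact mem_of_tendsto_hausdorffDist (fun i => (hA i).isBounded) hB hBb ⟨x, hx⟩ h
    (fun i => hAc i (ha i) (hb i) hs ht hst) ((hax.const_smul s).add (hby.const_smul t))

theorem hausdorffDist_add_smul_le (K : Set E) {A B : Set E} (hA : IsCompact A) (hA0 : A.Nonempty)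
    (hB : IsCompact B) (hB0 : B.Nonempty) {t : ℝ} (ht : 0 ≤ t) :
    Metric.hausdorffDist (K + t • A) (K + t • B) ≤ t * Metric.hausdorffDist A B := by
  have hdist {A B : Set E} (hA : IsCompact A) (hB : IsCompact B) (hB0 : B.Nonempty) :
      ∀ x ∈ K + t • A, ∃ y ∈ K + t • B, dist x y ≤ t * Metric.hausdorffDist A B := by
    rintro _ ⟨k, hk, _, ⟨a, ha, rfl⟩, rfl⟩
    obtain ⟨b, hb, hab⟩ := exists_dist_le_hausdorffDist hA.isBounded hB hB0 ha
    refine ⟨_, add_mem_add hk (smul_mem_smul_set hb), ?_⟩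
    simp only [dist_add_left, dist_smul₀, Real.norm_of_nonneg ht]
    gcongr
  refine Metric.hausdorffDist_le_of_mem_dist (mul_nonneg ht Metric.hausdorffDist_nonneg)
    (hdist hA hB hB0) ?_
  rw [Metric.hausdorffDist_comm]
  exact hdist hB hA hA0

theorem hausdorffDist_symmSegment_le (v w : E) :
    Metric.hausdorffDist (symmSegment v) (symmSegment w) ≤ dist v w := by
  have hdist (v w : E) : ∀ x ∈ symmSegment v, ∃ y ∈ symmSegment w, dist x y ≤ dist v w := by
    intro x hx
    rw [symmSegment_eq_image] at hx
    obtain ⟨s, hs, rfl⟩ := hx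
    refine ⟨s • w, symmSegment_eq_image w ▸ mem_image_of_mem _ hs, ?_⟩
    rw [dist_smul₀, Real.norm_eq_abs]
    exact mul_le_of_le_one_left dist_nonneg (abs_le.2 hs)
  exact Metric.hausdorffDist_le_of_mem_dist dist_nonneg (hdist v w)
    (by simpa only [dist_comm v w] using hdist w v)

theorem tendsto_hausdorffDist_symmSegment (v : E) :
    Tendsto (fun w => Metric.hausdorffDist (symmSegment w) (symmSegment v)) (𝓝 v) (𝓝 0) :=
  squeeze_zero (fun _ => Metric.hausdorffDist_nonneg) (fun w => hausdorffDist_symmSegment_le w v)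
    (tendsto_iff_dist_tendsto_zero.1 tendsto_id)

theorem subset_smul_of_closedBall_subset {A B : Set E} (hA : IsCompact A) (hAc : Convex ℝ A)
    {r : ℝ} (hr : 0 < r) (hrA : Metric.closedBall 0 r ⊆ A) (hB : Bornology.IsBounded B) :
    B ⊆ (1 + Metric.hausdorffDist B A / r) • A := by
  intro b hb
  have h0 : (0 : E) ∈ A := hrA (Metric.mem_closedBall_self hr.le)
  obtain ⟨a, ha, hba⟩ := exists_dist_le_hausdorffDist hB hA ⟨0, h0⟩ hb
  set δ := Metric.hausdorffDist B A
  have hδ : 0 ≤ δ / r := div_nonneg Metric.hausdorffDist_nonneg hr.le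
  have hsub : b - a ∈ (δ / r) • A := by
    refine smul_set_mono hrA ?_
    rwa [smul_closedBall _ _ hr.le, smul_zero, Real.norm_of_nonneg hδ, div_mul_cancel₀ _ hr.ne',
      mem_closedBall_zero_iff, ← dist_eq_norm]
  rw [hAc.add_smul zero_le_one hδ, one_smul]
  exact ⟨a, ha, b - a, hsub, add_sub_cancel a b⟩

end HausdorffNormed

section VolumeContinuity

variable {E ι : Type*} [NormedAddCommGroup E] [NormedSpace ℝ E] [FiniteDimensional ℝ E]
  [MeasurableSpace E] [BorelSpace E] (μ : Measure E) [μ.IsAddHaarMeasure] {f : Filter ι}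

theorem measureReal_le_of_closedBall_subset {A B : Set E} (hA : IsCompact A) (hAc : Convex ℝ A)
    {r : ℝ} (hr : 0 < r) (hrA : Metric.closedBall 0 r ⊆ A) (hB : Bornology.IsBounded B) :
    μ.real B ≤ (1 + Metric.hausdorffDist B A / r) ^ Module.finrank ℝ E * μ.real A := by
  have hs : 0 ≤ 1 + Metric.hausdorffDist B A / r := by
    have := Metric.hausdorffDist_nonneg (s := B) (t := A)
    positivity
  calc μ.real B ≤ μ.real ((1 + Metric.hausdorffDist B A / r) • A) :=
        measureReal_mono (subset_smul_of_closedBall_subset hA hAc hr hrA hB)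
          (hA.smul _).measure_ne_top
    _ = _ := by
        rw [measureReal_def, Measure.addHaar_smul_of_nonneg μ hs, ENNReal.toReal_mul,
          ENNReal.toReal_ofReal (pow_nonneg hs _), measureReal_def]

theorem tendsto_measureReal_of_tendsto_hausdorffDist {A : ι → Set E} {B : Set E}
    (hA : ∀ i, IsCompact (A i)) (hAc : ∀ i, Convex ℝ (A i)) (hB : IsCompact B) (hBc : Convex ℝ B)
    {r : ℝ} (hr : 0 < r) (hrA : ∀ i, Metric.closedBall 0 r ⊆ A i) (hrB : Metric.closedBall 0 r ⊆ B)
    (h : Tendsto (fun i => Metric.hausdorffDist (A i) B) f (𝓝 0)) :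
    Tendsto (fun i => μ.real (A i)) f (𝓝 (μ.real B)) := by
  have hfac : Tendsto (fun i => (1 + Metric.hausdorffDist (A i) B / r) ^ Module.finrank ℝ E) f
      (𝓝 1) := by
    simpa using ((h.div_const r).const_add 1).pow (Module.finrank ℝ E)
  refine tendsto_of_tendsto_of_tendsto_of_le_of_le
    (by simpa using (tendsto_const_nhds (x := μ.real B)).div hfac one_ne_zero)
    (by simpa using hfac.mul_const (μ.real B)) (fun i => ?_) (fun i => ?_)
  · have hpos : 0 < 1 + Metric.hausdorffDist (A i) B / r := by
      have := Metric.hausdorffDist_nonneg (s := A i) (t := B)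
      positivity
    refine (div_le_iff₀' (pow_pos hpos _)).2 ?_
    rw [Metric.hausdorffDist_comm]
    exact measureReal_le_of_closedBall_subset μ (hA i) (hAc i) hr (hrA i) hB.isBounded
  · exact measureReal_le_of_closedBall_subset μ hB hBc hr hrB (hA i).isBounded

theorem tendsto_measureReal_add_smul {K : Set E} (hKc : IsCompact K) (hK : Convex ℝ K)
    (hK0 : 0 ∈ interior K) {A : ι → Set E} {B : Set E}
    (hA : ∀ i, IsCompact (A i)) (hAc : ∀ i, Convex ℝ (A i)) (hA0 : ∀ i, 0 ∈ A i)
    (hB : IsCompact B) (hBc : Convex ℝ B) (hB0 : 0 ∈ B)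
    (h : Tendsto (fun i => Metric.hausdorffDist (A i) B) f (𝓝 0)) {t : ℝ} (ht : 0 ≤ t) :
    Tendsto (fun i => μ.real (K + t • A i)) f (𝓝 (μ.real (K + t • B))) := by
  obtain ⟨r, hr, hrK⟩ := Metric.nhds_basis_closedBall.mem_iff.1 (mem_interior_iff_mem_nhds.1 hK0)
  have hsub {S : Set E} (hS : 0 ∈ S) : Metric.closedBall 0 r ⊆ K + t • S := fun x hx =>
    ⟨x, hrK hx, 0, ⟨0, hS, smul_zero t⟩, add_zero x⟩
  refine tendsto_measureReal_of_tendsto_hausdorffDist μ (fun i => hKc.add ((hA i).smul t))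
    (fun i => hK.add ((hAc i).smul t)) (hKc.add (hB.smul t)) (hK.add (hBc.smul t)) hr
    (fun i => hsub (hA0 i)) (hsub hB0) ?_
  exact squeeze_zero (fun _ => Metric.hausdorffDist_nonneg)
    (fun i => hausdorffDist_add_smul_le K (hA i) ⟨0, hA0 i⟩ hB ⟨0, hB0⟩ ht)
    (by simpa using h.const_mul t)

end VolumeContinuity

section SegmentRateContinuity

variable {E : Type*} [NormedAddCommGroup E] [InnerProductSpace ℝ E] [FiniteDimensional ℝ E]
  [MeasurableSpace E] [BorelSpace E]

theorem continuous_segmentRate {K : Set E} (hKc : IsCompact K) (hK : Convex ℝ K)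
    (hK0 : 0 ∈ interior K) : Continuous (segmentRate K) := by
  have hrate (v) : segmentRate K v = volume.real (K + (1 : ℝ) • symmSegment v) - volume.real K := by
    rw [one_smul, volume_add_symmSegment hKc hK, add_sub_cancel_left]
  rw [funext hrate]
  refine continuous_iff_continuousAt.2 fun v => Tendsto.sub_const ?_ _
  exact tendsto_measureReal_add_smul volume hKc hK hK0 isCompact_symmSegment
    (fun w => convex_segment _ _) zero_mem_symmSegment (isCompact_symmSegment v)
    (convex_segment _ _) (zero_mem_symmSegment v) (tendsto_hausdorffDist_symmSegment v) zero_le_one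

end SegmentRateContinuity

section Zonoids

variable {n : ℕ} {M : Set (Rn n)}

theorem IsZonotope.exists_eq_zonotope {Z : Set (Rn n)} (hZ : IsZonotope Z) :
    ∃ l : List (Rn n), Z = zonotope l := by
  obtain ⟨N, v, rfl⟩ := hZ
  exact ⟨List.ofFn v, by rw [zonotope, List.map_ofFn, List.sum_ofFn]; rfl⟩

theorem IsZonoid.exists_tendsto_zonotope (hM : IsZonoid M) : ∃ l : ℕ → List (Rn n),
    Tendsto (fun i => Metric.hausdorffDist (zonotope (l i)) M) atTop (𝓝 0) := by
  obtain ⟨-, -, Z, hZ, hlim⟩ := hM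
  choose l hl using fun i => (hZ i).exists_eq_zonotope
  exact ⟨l, by simpa only [hl] using hlim⟩

theorem IsZonoid.zero_mem (hM : IsZonoid M) : 0 ∈ M := by
  obtain ⟨l, hl⟩ := hM.exists_tendsto_zonotope
  exact mem_of_tendsto_hausdorffDist (fun i => (isCompact_zonotope (l i)).isBounded)
    hM.1.isClosed hM.1.isBounded hM.2.1 hl (fun i => zero_mem_zonotope (l i)) tendsto_const_nhds

theorem IsZonoid.convex (hM : IsZonoid M) : Convex ℝ M := by
  obtain ⟨l, hl⟩ := hM.exists_tendsto_zonotope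
  exact convex_of_tendsto_hausdorffDist (fun i => isCompact_zonotope (l i))
    (fun i => ⟨0, zero_mem_zonotope (l i)⟩) (fun i => convex_zonotope (l i))
    hM.1.isClosed hM.1.isBounded hl

theorem IsZonoid.tendsto_mixedVol {K : Set (Rn n)} (hKc : IsCompact K) (hK : Convex ℝ K)
    (hK0 : 0 ∈ interior K) (hM : IsZonoid M) {l : ℕ → List (Rn n)}
    (hl : Tendsto (fun i => Metric.hausdorffDist (zonotope (l i)) M) atTop (𝓝 0)) (k : ℕ) :
    Tendsto (fun i => mixedVol k K (zonotope (l i))) atTop (𝓝 (mixedVol k K M)) :=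
  tendsto_mixedVol_of_tendsto_volume hKc hK (fun _ ht =>
    tendsto_measureReal_add_smul volume hKc hK hK0 (fun i => isCompact_zonotope (l i))
      (fun i => convex_zonotope (l i)) (fun i => zero_mem_zonotope (l i)) hM.1 hM.convex
      hM.zero_mem hl ht) k

end Zonoids

section SupportFunction

variable {n : ℕ} {K A B : Set (Rn n)}

theorem inner_le_supportFn (hA : IsCompact A) {y : Rn n} (hy : y ∈ A) (u : Rn n) :
    ⟪u, y⟫_ℝ ≤ supportFn A u :=
  le_csSup (hA.image (by fun_prop)).bddAbove (mem_image_of_mem _ hy)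

theorem continuous_supportFn (hA : IsCompact A) : Continuous (supportFn A) :=
  hA.continuous_sSup (f := fun u y : Rn n => ⟪u, y⟫_ℝ) (by fun_prop)

theorem supportFn_pos (hK : IsCompact K) (hK0 : 0 ∈ interior K) {u : Rn n} (hu : u ≠ 0) :
    0 < supportFn K u := by
  have hline : Tendsto (fun t : ℝ => t • u) (𝓝[>] 0) (𝓝 0) := by
    simpa using (tendsto_id.smul_const u).mono_left (nhdsWithin_le_nhds (a := (0 : ℝ)) (s := Ioi 0))
  obtain ⟨t, htK, ht⟩ :=
    ((hline.eventually_mem (mem_interior_iff_mem_nhds.1 hK0)).and self_mem_nhdsWithin).exists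
  refine lt_of_lt_of_le ?_ (inner_le_supportFn hK htK u)
  rw [inner_smul_right]
  exact mul_pos ht (real_inner_self_pos.2 hu)

theorem supportFn_singleton_zero (u : Rn n) : supportFn {0} u = 0 := by
  simp [supportFn]

theorem supportFn_add (hA : IsCompact A) (hA0 : A.Nonempty) (hB : IsCompact B) (hB0 : B.Nonempty)
    (u : Rn n) : supportFn (A + B) u = supportFn A u + supportFn B u := by
  have himage : (⟪u, ·⟫_ℝ) '' (A + B) = (⟪u, ·⟫_ℝ) '' A + (⟪u, ·⟫_ℝ) '' B :=
    image_add (innerSL ℝ u)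
  rw [supportFn, himage, csSup_add (hA0.image _) (hA.image (by fun_prop)).bddAbove (hB0.image _)
    (hB.image (by fun_prop)).bddAbove, supportFn, supportFn]

theorem supportFn_symmSegment (v u : Rn n) : supportFn (symmSegment v) u = |⟪u, v⟫_ℝ| := by
  refine IsGreatest.csSup_eq ⟨?_, ?_⟩
  · rcases abs_choice ⟪u, v⟫_ℝ with h | h
    · exact ⟨v, right_mem_segment _ _ _, h.symm⟩
    · exact ⟨-v, left_mem_segment _ _ _, by simp [h]⟩
  · rw [symmSegment_eq_image]
    rintro _ ⟨_, ⟨s, hs, rfl⟩, rfl⟩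
    calc ⟪u, s • v⟫_ℝ ≤ |s| * |⟪u, v⟫_ℝ| := by
          rw [inner_smul_right, ← abs_mul]
          exact le_abs_self _
      _ ≤ |⟪u, v⟫_ℝ| := mul_le_of_le_one_left (abs_nonneg _) (abs_le.2 hs)

theorem abs_supportFn_sub_le (hA : IsCompact A) (hA0 : A.Nonempty) (hB : IsCompact B)
    (hB0 : B.Nonempty) (u : Rn n) :
    |supportFn A u - supportFn B u| ≤ ‖u‖ * Metric.hausdorffDist A B := by
  have hle {A B : Set (Rn n)} (hA : IsCompact A) (hA0 : A.Nonempty) (hB : IsCompact B)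
      (hB0 : B.Nonempty) : supportFn A u ≤ supportFn B u + ‖u‖ * Metric.hausdorffDist A B := by
    refine csSup_le (hA0.image _) ?_
    rintro _ ⟨a, ha, rfl⟩
    obtain ⟨b, hb, hab⟩ := exists_dist_le_hausdorffDist hA.isBounded hB hB0 ha
    calc ⟪u, a⟫_ℝ = ⟪u, b⟫_ℝ + ⟪u, a - b⟫_ℝ := by rw [← inner_add_right, add_sub_cancel]
      _ ≤ supportFn B u + ‖u‖ * Metric.hausdorffDist A B := by
        refine add_le_add (inner_le_supportFn hB hb u) ((real_inner_le_norm u _).trans ?_)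
        rw [← dist_eq_norm]
        gcongr
  rw [abs_sub_le_iff, sub_le_iff_le_add', sub_le_iff_le_add']
  exact ⟨hle hA hA0 hB hB0, Metric.hausdorffDist_comm (s := A) ▸ hle hB hB0 hA hA0⟩

theorem tendsto_supportFn {ι : Type*} {f : Filter ι} {A : ι → Set (Rn n)}
    (hA : ∀ i, IsCompact (A i)) (hA0 : ∀ i, (A i).Nonempty) (hB : IsCompact B) (hB0 : B.Nonempty)
    (h : Tendsto (fun i => Metric.hausdorffDist (A i) B) f (𝓝 0)) (u : Rn n) :
    Tendsto (fun i => supportFn (A i) u) f (𝓝 (supportFn B u)) :=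
  tendsto_iff_dist_tendsto_zero.2 <| squeeze_zero (fun _ => dist_nonneg)
    (fun i => abs_supportFn_sub_le (hA i) (hA0 i) hB hB0 u) (by simpa using h.const_mul ‖u‖)

end SupportFunction

section SurfaceArea

variable {n : ℕ} {K : Set (Rn n)}

theorem neg_two_mul_norm_le_of_isOuterUnitNormal {e x y u z : Rn n} {c : ℝ}
    (hu : IsOuterUnitNormal K x u) (hue : 1 / 2 < ⟪u, e⟫_ℝ) (hy : y ∈ K)
    (hxy : x - y = c • e + z) : -(2 * ‖z‖) ≤ c := by
  have hnormal : 0 ≤ c * ⟪u, e⟫_ℝ + ⟪u, z⟫_ℝ := by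
    rw [← inner_smul_right, ← inner_add_right, ← hxy, inner_sub_right]
    exact sub_nonneg.2 (hu.2 y hy)
  have hz : ⟪u, z⟫_ℝ ≤ ‖z‖ := by simpa [hu.1] using real_inner_le_norm u z
  by_contra! hc
  nlinarith [norm_nonneg z]

/-- The points of `K` with an outer unit normal making an angle less than `π / 3` with `e`. The
part of the boundary of `K` in such a cap is a Lipschitz graph over the hyperplane `e^⊥`. -/
def normalCap (K : Set (Rn n)) (e : Rn n) : Set (Rn n) :=
  {x | x ∈ K ∧ ∃ u, IsOuterUnitNormal K x u ∧ 1 / 2 < ⟪u, e⟫_ℝ}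

theorem dist_le_of_mem_normalCap {e x y : Rn n} (he : ‖e‖ = 1) (hx : x ∈ normalCap K e)
    (hy : y ∈ normalCap K e) : dist x y ≤ 3 * dist (hyperProj e x) (hyperProj e y) := by
  obtain ⟨hxK, u, hu, hue⟩ := hx
  obtain ⟨hyK, w, hw, hwe⟩ := hy
  obtain ⟨s, hs⟩ := exists_eq_smul_add_hyperProj e (x - y)
  set z := (hyperProj e (x - y) : Rn n) with hz
  have hdist : dist (hyperProj e x) (hyperProj e y) = ‖z‖ := by
    rw [dist_eq_norm, ← map_sub, hz, Submodule.norm_coe]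
  have hsz : |s| ≤ 2 * ‖z‖ := by
    refine abs_le.2 ⟨neg_two_mul_norm_le_of_isOuterUnitNormal hu hue hyK hs, neg_le_neg_iff.1 ?_⟩
    rw [← norm_neg z]
    refine neg_two_mul_norm_le_of_isOuterUnitNormal hw hwe hxK ?_
    rw [← neg_sub x y, hs]
    module
  calc dist x y = ‖s • e + z‖ := by rw [dist_eq_norm, hs]
    _ ≤ ‖s • e‖ + ‖z‖ := norm_add_le _ _
    _ = |s| + ‖z‖ := by rw [norm_smul, he, mul_one, Real.norm_eq_abs]
    _ ≤ 3 * dist (hyperProj e x) (hyperProj e y) := by rw [hdist]; linarith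

theorem measure_normalCap_lt_top (hK : IsCompact K) {e : Rn n} (he : ‖e‖ = 1) :
    (μHE[n - 1] : Measure (Rn n)) (normalCap K e) < ⊤ := by
  have hanti : AntilipschitzWith 3 (fun x : normalCap K e => hyperProj e (x : Rn n)) :=
    AntilipschitzWith.of_le_mul_dist fun x y => dist_le_of_mem_normalCap he x.2 y.2
  have hle := hanti.le_hausdorffMeasure_image (d := ((n - 1 : ℕ) : ℝ)) (by positivity) univ
  rw [← isometry_subtype_coe.hausdorffMeasure_image (Or.inl (by positivity)), image_univ,
    Subtype.range_coe, image_univ] at hle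
  have hsub : (range fun x : normalCap K e => hyperProj e (x : Rn n)) ⊆ hyperProj e '' K := by
    rintro _ ⟨x, rfl⟩
    exact mem_image_of_mem _ x.2.1
  have hfinrank : Module.finrank ℝ (ℝ ∙ e)ᗮ = n - 1 := by
    have := finrank_orthogonal_span_singleton_add_one (norm_ne_zero_iff.1 (he ▸ one_ne_zero))
    rw [finrank_euclideanSpace_fin] at this
    omega
  have hproj : (μHE[n - 1] : Measure (ℝ ∙ e)ᗮ) (hyperProj e '' K) < ⊤ := by
    rw [← hfinrank, InnerProductSpace.euclideanHausdorffMeasure_eq_volume]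
    exact (hK.image (hyperProj e).continuous).measure_lt_top
  rw [Measure.euclideanHausdorffMeasure_def, Measure.smul_apply, ENNReal.smul_def] at hproj ⊢
  have hproj' := ENNReal.lt_top_of_mul_ne_top_right hproj.ne
    (by exact_mod_cast Measure.addHaarScalarFactor_volume_hausdorffMeasure_ne_zero _)
  refine ENNReal.mul_lt_top ENNReal.coe_lt_top (hle.trans_lt (ENNReal.mul_lt_top ?_
    ((measure_mono hsub).trans_lt hproj')))
  exact ENNReal.rpow_lt_top_of_nonneg (by positivity) (by simp)

theorem measure_regularBoundary_lt_top (hK : IsCompact K) :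
    (μHE[n - 1] : Measure (Rn n)) (regularBoundary K) < ⊤ := by
  obtain ⟨T, hT, hfin, hcov⟩ := (isCompact_sphere (0 : Rn n) 1).finite_cover_balls one_pos
  have hT1 : ∀ e ∈ T, ‖e‖ = 1 := fun e he => mem_sphere_zero_iff_norm.1 (hT he)
  refine (measure_mono ?_).trans_lt
    (measure_biUnion_lt_top (s := T) (f := normalCap K) hfin fun e he =>
      measure_normalCap_lt_top hK (hT1 e he))
  rintro x ⟨hx, u, hu, -⟩
  obtain ⟨e, he, hue⟩ := mem_iUnion₂.1 (hcov (mem_sphere_zero_iff_norm.2 hu.1))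
  refine mem_iUnion₂.2 ⟨e, he, hK.isClosed.frontier_subset hx, u, hu, ?_⟩
  rw [Metric.mem_ball, dist_eq_norm] at hue
  have hpolar := norm_sub_sq_real u e
  rw [hu.1, hT1 e he] at hpolar
  nlinarith [norm_nonneg (u - e)]

theorem isFiniteMeasure_surfaceAreaMeasure (hK : IsCompact K) :
    IsFiniteMeasure (surfaceAreaMeasure K) := by
  refine ⟨?_⟩
  rw [surfaceAreaMeasure, Measure.map_apply (measurable_gaussMap hK) MeasurableSet.univ,
    preimage_univ, Measure.restrict_apply_univ]
  exact measure_regularBoundary_lt_top hK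

theorem ae_mem_sphere_surfaceAreaMeasure (hK : IsCompact K) :
    ∀ᵐ u ∂surfaceAreaMeasure K, u ∈ Metric.sphere (0 : Rn n) 1 := by
  rw [surfaceAreaMeasure, ae_map_iff (p := (· ∈ Metric.sphere 0 1))
    (measurable_gaussMap hK).aemeasurable Metric.isClosed_sphere.measurableSet]
  refine (ae_restrict_mem (measurableSet_regularBoundary hK)).mono fun x hx => ?_
  rw [gaussMap, dif_pos hx]
  exact mem_sphere_zero_iff_norm.2 hx.2.choose_spec.1.1

theorem integrable_surfaceAreaMeasure_of_continuousOn (hK : IsCompact K) {g : Rn n → ℝ}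
    (hg : ContinuousOn g (Metric.sphere 0 1)) : Integrable g (surfaceAreaMeasure K) := by
  have := isFiniteMeasure_surfaceAreaMeasure hK
  rw [← Measure.restrict_eq_self_of_ae_mem (ae_mem_sphere_surfaceAreaMeasure hK)]
  exact hg.integrableOn_compact (isCompact_sphere 0 1)

end SurfaceArea

section SupportPairing

variable {n : ℕ} {K A B C : Set (Rn n)}

/-- The pairing `∫ h_A h_B / h_K dS_K`, a bilinear form in `A` and `B` for Minkowski addition,
whose diagonal is the integral of `h_M² / h_K`. -/
noncomputable def supportPairing (K A B : Set (Rn n)) : ℝ :=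
  ∫ u, supportFn A u * supportFn B u / supportFn K u ∂surfaceAreaMeasure K

theorem supportPairing_self (K M : Set (Rn n)) :
    supportPairing K M M = ∫ u, supportFn M u ^ 2 / supportFn K u ∂surfaceAreaMeasure K := by
  simp only [supportPairing, sq]

theorem supportPairing_comm (K A B : Set (Rn n)) :
    supportPairing K A B = supportPairing K B A := by
  simp only [supportPairing, mul_comm]

theorem supportPairing_symmSegment (K : Set (Rn n)) (v w : Rn n) :
    supportPairing K (symmSegment v) (symmSegment w) =
      ∫ u, |⟪u, v⟫_ℝ| * |⟪u, w⟫_ℝ| / supportFn K u ∂surfaceAreaMeasure K := by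
  simp only [supportPairing, supportFn_symmSegment]

theorem supportPairing_singleton_zero_right (K A : Set (Rn n)) : supportPairing K A {0} = 0 := by
  simp only [supportPairing, supportFn_singleton_zero, mul_zero, zero_div, integral_zero]

theorem supportPairing_symmSegment_smul_right (K A : Set (Rn n)) (a : ℝ) (v : Rn n) :
    supportPairing K A (symmSegment (a • v)) = |a| * supportPairing K A (symmSegment v) := by
  rw [supportPairing, supportPairing, ← integral_const_mul]
  refine integral_congr_ae (.of_forall fun u => ?_)
  simp only [supportFn_symmSegment, inner_smul_right, abs_mul]
  ring

theorem integrable_div_supportFn (hK : IsCompact K) (hK0 : 0 ∈ interior K) {g : Rn n → ℝ}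
    (hg : Continuous g) : Integrable (fun u => g u / supportFn K u) (surfaceAreaMeasure K) :=
  integrable_surfaceAreaMeasure_of_continuousOn hK <|
    hg.continuousOn.div (continuous_supportFn hK).continuousOn fun _ hu =>
      (supportFn_pos hK hK0 (ne_zero_of_mem_unit_sphere ⟨_, hu⟩)).ne'

theorem supportPairing_add_right (hK : IsCompact K) (hK0 : 0 ∈ interior K) (hA : IsCompact A)
    (hB : IsCompact B) (hB0 : B.Nonempty) (hC : IsCompact C) (hC0 : C.Nonempty) :
    supportPairing K A (B + C) = supportPairing K A B + supportPairing K A C := by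
  have hint {D : Set (Rn n)} (hD : IsCompact D) :
      Integrable (fun u => supportFn A u * supportFn D u / supportFn K u) (surfaceAreaMeasure K) :=
    integrable_div_supportFn hK hK0 ((continuous_supportFn hA).mul (continuous_supportFn hD))
  rw [supportPairing, supportPairing, supportPairing, ← integral_add (hint hB) (hint hC)]
  simp only [supportFn_add hB hB0 hC hC0, mul_add, add_div]

theorem tendsto_supportPairing (hK : IsCompact K) (hK0 : 0 ∈ interior K) {ι : Type*}
    {f : Filter ι} [f.IsCountablyGenerated] {A' B' : ι → Set (Rn n)}
    (hA' : ∀ i, IsCompact (A' i)) (hA'0 : ∀ i, (A' i).Nonempty) (hA : IsCompact A)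
    (hA0 : A.Nonempty) (hB' : ∀ i, IsCompact (B' i)) (hB'0 : ∀ i, (B' i).Nonempty)
    (hB : IsCompact B) (hB0 : B.Nonempty)
    (hAlim : Tendsto (fun i => Metric.hausdorffDist (A' i) A) f (𝓝 0))
    (hBlim : Tendsto (fun i => Metric.hausdorffDist (B' i) B) f (𝓝 0)) :
    Tendsto (fun i => supportPairing K (A' i) (B' i)) f (𝓝 (supportPairing K A B)) := by
  have hcont {D : Set (Rn n)} (hD : IsCompact D) := continuous_supportFn hD
  have hbound {D' D : Set (Rn n)} (hD' : IsCompact D') (hD'0 : D'.Nonempty) (hD : IsCompact D)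
      (hD0 : D.Nonempty) (hdist : Metric.hausdorffDist D' D < 1) {u : Rn n} (hu : ‖u‖ = 1) :
      |supportFn D' u| ≤ |supportFn D u| + 1 := by
    have hsub := abs_supportFn_sub_le hD' hD'0 hD hD0 u
    rw [hu, one_mul] at hsub
    linarith [abs_sub_abs_le_abs_sub (supportFn D' u) (supportFn D u)]
  refine tendsto_integral_filter_of_dominated_convergence
    (fun u => (|supportFn A u| + 1) * (|supportFn B u| + 1) / supportFn K u)
    (.of_forall fun i => (integrable_div_supportFn hK hK0
      ((hcont (hA' i)).mul (hcont (hB' i)))).aestronglyMeasurable) ?_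
    (integrable_div_supportFn hK hK0
      (((hcont hA).abs.add continuous_const).mul ((hcont hB).abs.add continuous_const)))
    (.of_forall fun u => ((tendsto_supportFn hA' hA'0 hA hA0 hAlim u).mul
      (tendsto_supportFn hB' hB'0 hB hB0 hBlim u)).div_const _)
  filter_upwards [hAlim.eventually_lt_const one_pos, hBlim.eventually_lt_const one_pos]
    with i hiA hiB
  filter_upwards [ae_mem_sphere_surfaceAreaMeasure hK] with u hu
  have hu1 := mem_sphere_zero_iff_norm.1 hu
  have hpos := supportFn_pos hK hK0 (ne_zero_of_mem_unit_sphere ⟨u, hu⟩)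
  rw [Real.norm_eq_abs, abs_div, abs_mul, abs_of_pos hpos]
  gcongr
  · exact hbound (hA' i) (hA'0 i) hA hA0 hiA hu1
  · exact hbound (hB' i) (hB'0 i) hB hB0 hiB hu1

end SupportPairing

section IteratedProjection

variable {E : Type*} [NormedAddCommGroup E] [InnerProductSpace ℝ E]

theorem hyperProj_eq_zero_iff {v w : E} : hyperProj v w = 0 ↔ w ∈ ℝ ∙ v := by
  rw [Submodule.orthogonalProjectionOnto_eq_zero_iff, Submodule.orthogonal_orthogonal]

theorem linearIndependent_pair_iff_hyperProj_ne_zero {v w : E} (hv : v ≠ 0) :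
    LinearIndependent ℝ ![v, w] ↔ hyperProj v w ≠ 0 := by
  rw [LinearIndependent.pair_iff' hv, Ne, hyperProj_eq_zero_iff, Submodule.mem_span_singleton,
    not_exists]

theorem hyperProj_hyperProj_eq_starProjection (v w x : E)
    [(Submodule.span ℝ {v, w}).HasOrthogonalProjection] :
    ((hyperProj (hyperProj v w) (hyperProj v x) : (ℝ ∙ v)ᗮ) : E) =
      (Submodule.span ℝ {v, w})ᗮ.starProjection x := by
  obtain ⟨a, ha⟩ := exists_eq_smul_add_hyperProj v x
  obtain ⟨b, hb⟩ := exists_eq_smul_add_hyperProj v w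
  obtain ⟨c, hc⟩ := exists_eq_smul_add_hyperProj (hyperProj v w) (hyperProj v x)
  set y := hyperProj (hyperProj v w) (hyperProj v x)
  have hvy : ⟪v, ((y : (ℝ ∙ v)ᗮ) : E)⟫_ℝ = 0 :=
    Submodule.mem_orthogonal_singleton_iff_inner_right.1 (y : (ℝ ∙ v)ᗮ).2
  have hPy : ⟪(hyperProj v w : E), ((y : (ℝ ∙ v)ᗮ) : E)⟫_ℝ = 0 := by
    rw [← Submodule.coe_inner]
    exact Submodule.mem_orthogonal_singleton_iff_inner_right.1 y.2
  replace hc : (hyperProj v x : E) = c • (hyperProj v w : E) + ((y : (ℝ ∙ v)ᗮ) : E) :=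
    congrArg Subtype.val hc
  generalize ((y : (ℝ ∙ v)ᗮ) : E) = z at hvy hPy hc ⊢
  have hwz : ⟪w, z⟫_ℝ = 0 := by
    rw [hb, inner_add_left, real_inner_smul_left, hvy, hPy, mul_zero, zero_add]
  refine (Submodule.eq_starProjection_of_mem_orthogonal ?_
    (Submodule.le_orthogonal_orthogonal _ ?_)).symm
  · refine (Submodule.mem_orthogonal _ _).2 fun u hu => ?_
    obtain ⟨p, q, rfl⟩ := Submodule.mem_span_pair.1 hu
    rw [inner_add_left, real_inner_smul_left, real_inner_smul_left, hvy, hwz, mul_zero, mul_zero,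
      add_zero]
  · refine Submodule.mem_span_pair.2 ⟨a - c * b, c, ?_⟩
    rw [eq_sub_iff_add_eq, ha, hc]
    nth_rewrite 1 [hb]
    module

theorem norm_hyperProj {v w : E} (hv : ‖v‖ = 1) (hw : ‖w‖ = 1) :
    ‖hyperProj v w‖ = √(1 - ⟪v, w⟫_ℝ ^ 2) := by
  have hpyth := (ℝ ∙ v).norm_sq_eq_add_norm_sq_starProjection w
  rw [Submodule.starProjection_unit_singleton ℝ hv, norm_smul, hv, hw, mul_one, one_pow,
    Real.norm_eq_abs, sq_abs] at hpyth
  rw [hpyth, add_sub_cancel_left, Real.sqrt_sq (norm_nonneg _), Submodule.starProjection_apply,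
    Submodule.norm_coe]

theorem dense_setOf_linearIndependent_pair {v : E} (hv : v ≠ 0)
    (hE : 1 < Module.finrank ℝ E) : Dense {w | LinearIndependent ℝ ![v, w]} := by
  have hline : {w | LinearIndependent ℝ ![v, w]} = ((ℝ ∙ v : Submodule ℝ E) : Set E)ᶜ := by
    ext w
    exact (linearIndependent_pair_iff_hyperProj_ne_zero hv).trans hyperProj_eq_zero_iff.not
  rw [hline, ← interior_eq_empty_iff_dense_compl, ← not_nonempty_iff_eq_empty]
  intro hne
  rw [← finrank_top ℝ E, ← (ℝ ∙ v).eq_top_of_nonempty_interior' hne,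
    finrank_span_singleton hv] at hE
  exact hE.false

end IteratedProjection

section ProjectionVolumes

variable {n : ℕ} {K : Set (Rn n)}

theorem projSet_eq_image (K : Set (Rn n)) (H : Submodule ℝ (Rn n)) :
    projSet K H = H.starProjection '' K := by
  ext x
  constructor
  · rintro ⟨hx, y, hy, hxy⟩
    exact ⟨x + y, hxy, Submodule.eq_starProjection_of_mem_orthogonal' hx hy rfl⟩
  · rintro ⟨k, hk, rfl⟩
    exact ⟨H.starProjection_apply_mem k, k - H.starProjection k,
      H.sub_starProjection_mem_orthogonal k, by rwa [add_sub_cancel]⟩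

theorem projVol_eq_volume {V : Type*} [NormedAddCommGroup V] [InnerProductSpace ℝ V]
    [FiniteDimensional ℝ V] [MeasurableSpace V] [BorelSpace V] {k : ℕ}
    (hV : Module.finrank ℝ V = k) {H : Submodule ℝ (Rn n)} {f : V → Rn n} (hf : Isometry f)
    {S : Set V} (hS : f '' S = projSet K H) : projVol k K H = volume.real S := by
  rw [projVol, ← hS, measureReal_def, hf.euclideanHausdorffMeasure_image, ← hV,
    InnerProductSpace.euclideanHausdorffMeasure_eq_volume, measureReal_def]

theorem segmentRate_eq_projVol (K : Set (Rn n)) {v : Rn n} (hv : v ≠ 0) :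
    segmentRate K v = 2 * ‖v‖ * projVol (n - 1) K (ℝ ∙ v)ᗮ := by
  have hfinrank : Module.finrank ℝ (ℝ ∙ v)ᗮ = n - 1 := by
    rw [Nat.eq_sub_of_add_eq (finrank_orthogonal_span_singleton_add_one hv),
      finrank_euclideanSpace_fin]
  rw [segmentRate, projVol_eq_volume hfinrank isometry_subtype_coe (S := hyperProj v '' K)]
  rw [projSet_eq_image, image_image]
  rfl

theorem segmentRate₂_eq_projVol (K : Set (Rn n)) {v w : Rn n}
    (h : LinearIndependent ℝ ![v, w]) :
    segmentRate₂ K v w =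
      4 * ‖v‖ * ‖hyperProj v w‖ * projVol (n - 2) K (Submodule.span ℝ {v, w})ᗮ := by
  have hv : v ≠ 0 := h.ne_zero 0
  have hw := (linearIndependent_pair_iff_hyperProj_ne_zero hv).1 h
  have hfinrank : Module.finrank ℝ (ℝ ∙ hyperProj v w)ᗮ = n - 2 := by
    rw [Nat.eq_sub_of_add_eq (finrank_orthogonal_span_singleton_add_one hw),
      Nat.eq_sub_of_add_eq (finrank_orthogonal_span_singleton_add_one hv),
      finrank_euclideanSpace_fin, Nat.sub_sub]
  rw [segmentRate₂, segmentRate, projVol_eq_volume hfinrank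
    (isometry_subtype_coe.comp isometry_subtype_coe)
    (S := hyperProj (hyperProj v w) '' (hyperProj v '' K))]
  · ring
  · rw [projSet_eq_image, image_image, image_image]
    exact image_congr fun x _ => hyperProj_hyperProj_eq_starProjection v w x

end ProjectionVolumes

section PairInequality

variable {n : ℕ} {K : Set (Rn n)}

/-- The bound assumed of `K`: for independent unit vectors `v` and `w`, the mixed rate of
`[-v, v]` and `[-w, w]` plus the pairing of their support functions is at most the product of
their rates divided by `|K|`, written in terms of the projections of `K` along `v` and `w`. -/
def UnitPairInequality (K : Set (Rn n)) : Prop :=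
  ∀ v w : Rn n, ‖v‖ = 1 → ‖w‖ = 1 → LinearIndependent ℝ ![v, w] →
    4 * √(1 - ⟪v, w⟫_ℝ ^ 2) * projVol (n - 2) K (Submodule.span ℝ {v, w})ᗮ
      + ∫ u, |⟪u, v⟫_ℝ| * |⟪u, w⟫_ℝ| / supportFn K u ∂(surfaceAreaMeasure K)
    ≤ 4 * projVol (n - 1) K (Submodule.span ℝ {v})ᗮ
        * projVol (n - 1) K (Submodule.span ℝ {w})ᗮ / volume.real K

theorem segmentRate₂_nonneg {E : Type*} [NormedAddCommGroup E] [InnerProductSpace ℝ E]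
    [FiniteDimensional ℝ E] [MeasurableSpace E] [BorelSpace E] (L : Set E) (v w : E) :
    0 ≤ segmentRate₂ L v w :=
  mul_nonneg (by positivity) (segmentRate_nonneg _ _)

theorem UnitPairInequality.add_le_of_norm_eq_one (hyp : UnitPairInequality K) {v w : Rn n}
    (hv : ‖v‖ = 1) (hw : ‖w‖ = 1) (h : LinearIndependent ℝ ![v, w]) :
    segmentRate₂ K v w + supportPairing K (symmSegment v) (symmSegment w) ≤
      segmentRate K v * segmentRate K w / volume.real K := by
  have hv0 : v ≠ 0 := h.ne_zero 0
  have hw0 : w ≠ 0 := h.ne_zero 1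
  rw [segmentRate₂_eq_projVol K h, segmentRate_eq_projVol K hv0, segmentRate_eq_projVol K hw0,
    norm_hyperProj hv hw, hv, hw, supportPairing_symmSegment]
  convert hyp v w hv hw h using 2 <;> ring

theorem UnitPairInequality.add_le_of_linearIndependent (hyp : UnitPairInequality K) {v w : Rn n}
    (h : LinearIndependent ℝ ![v, w]) :
    segmentRate₂ K v w + supportPairing K (symmSegment v) (symmSegment w) ≤
      segmentRate K v * segmentRate K w / volume.real K := by
  obtain ⟨a, ha, x, hx, rfl⟩ : ∃ a : ℝ, 0 < a ∧ ∃ x : Rn n, ‖x‖ = 1 ∧ a • x = v :=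
    ⟨‖v‖, norm_pos_iff.2 (h.ne_zero 0), _, NormedSpace.norm_normalize (h.ne_zero 0),
      NormedSpace.norm_smul_normalize v⟩
  obtain ⟨b, hb, y, hy, rfl⟩ : ∃ b : ℝ, 0 < b ∧ ∃ y : Rn n, ‖y‖ = 1 ∧ b • y = w :=
    ⟨‖w‖, norm_pos_iff.2 (h.ne_zero 1), _, NormedSpace.norm_normalize (h.ne_zero 1),
      NormedSpace.norm_smul_normalize w⟩
  have hxy : LinearIndependent ℝ ![x, y] :=
    (LinearIndependent.pair_smul_smul_iff ha.ne'.isUnit hb.ne'.isUnit).1 h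
  rw [segmentRate_smul, segmentRate_smul, segmentRate₂_smul_left, segmentRate₂_smul_right,
    supportPairing_symmSegment_smul_right, supportPairing_comm,
    supportPairing_symmSegment_smul_right, supportPairing_comm, abs_of_pos ha, abs_of_pos hb]
  calc a * (b * segmentRate₂ K x y) + b * (a * supportPairing K (symmSegment x) (symmSegment y))
      = a * b * (segmentRate₂ K x y + supportPairing K (symmSegment x) (symmSegment y)) := by ring
    _ ≤ a * b * (segmentRate K x * segmentRate K y / volume.real K) :=
        mul_le_mul_of_nonneg_left (hyp.add_le_of_norm_eq_one hx hy hxy) (mul_pos ha hb).le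
    _ = a * segmentRate K x * (b * segmentRate K y) / volume.real K := by ring

theorem continuous_supportPairing_symmSegment (hKc : IsCompact K) (hK0 : 0 ∈ interior K)
    {A : Set (Rn n)} (hA : IsCompact A) (hA0 : A.Nonempty) :
    Continuous fun w => supportPairing K A (symmSegment w) :=
  continuous_iff_continuousAt.2 fun w =>
    tendsto_supportPairing hKc hK0 (fun _ => hA) (fun _ => hA0) hA hA0
      (fun u => isCompact_symmSegment u) (fun u => ⟨0, zero_mem_symmSegment u⟩)
      (isCompact_symmSegment w) ⟨0, zero_mem_symmSegment w⟩
      (by simp only [Metric.hausdorffDist_self_zero, tendsto_const_nhds])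
      (tendsto_hausdorffDist_symmSegment w)

variable (hn : 2 ≤ n) (hKc : IsCompact K) (hK : Convex ℝ K) (hK0 : 0 ∈ interior K)
  (hyp : UnitPairInequality K)
include hn hKc hK hK0 hyp

/-- The mixed rate of an independent pair is nonnegative, and the inequality without it is closed
in `w`, so it extends to dependent pairs. -/
theorem UnitPairInequality.supportPairing_le (v w : Rn n) :
    supportPairing K (symmSegment v) (symmSegment w) ≤
      segmentRate K v * segmentRate K w / volume.real K := by
  rcases eq_or_ne v 0 with rfl | hv
  · simp only [symmSegment, neg_zero, segment_same, supportPairing_comm K {0},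
      supportPairing_singleton_zero_right, segmentRate_zero_right, zero_mul, zero_div, le_refl]
  have hclosed : IsClosed {w | supportPairing K (symmSegment v) (symmSegment w) ≤
      segmentRate K v * segmentRate K w / volume.real K} :=
    isClosed_le (continuous_supportPairing_symmSegment hKc hK0 (isCompact_symmSegment v)
        ⟨0, zero_mem_symmSegment v⟩)
      ((continuous_const.mul (continuous_segmentRate hKc hK hK0)).div_const _)
  have hdense := dense_setOf_linearIndependent_pair hv
    (hn.trans_eq finrank_euclideanSpace_fin.symm)
  refine hclosed.closure_subset_iff.2 (fun w hw => ?_) (hdense w)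
  exact (le_add_of_nonneg_left (segmentRate₂_nonneg K v w)).trans
    (hyp.add_le_of_linearIndependent hw)

theorem UnitPairInequality.add_le (v w : Rn n) :
    segmentRate₂ K v w + supportPairing K (symmSegment v) (symmSegment w) ≤
      segmentRate K v * segmentRate K w / volume.real K := by
  by_cases h : v ≠ 0 ∧ LinearIndependent ℝ ![v, w]
  · exact hyp.add_le_of_linearIndependent h.2
  have hzero : segmentRate₂ K v w = 0 := by
    rcases eq_or_ne v 0 with rfl | hv
    · simp [segmentRate₂]
    · have hproj : hyperProj v w = 0 := by
        by_contra hw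
        exact h ⟨hv, (linearIndependent_pair_iff_hyperProj_ne_zero hv).2 hw⟩
      rw [segmentRate₂, hproj, segmentRate_zero_right, mul_zero]
  rw [hzero, zero_add]
  exact hyp.supportPairing_le hn hKc hK hK0 v w

end PairInequality

section ZonoidInequality

variable {n : ℕ} {K M : Set (Rn n)}

section

variable (hn : 2 ≤ n) (hKc : IsCompact K) (hK : Convex ℝ K) (hK0 : 0 ∈ interior K)
  (hyp : UnitPairInequality K)
include hn hKc hK hK0 hyp

theorem UnitPairInequality.sum_segmentRate₂_add_le (v : Rn n) (l : List (Rn n)) :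
    (l.map (segmentRate₂ K v)).sum + supportPairing K (symmSegment v) (zonotope l) ≤
      segmentRate K v * (l.map (segmentRate K)).sum / volume.real K := by
  induction l with
  | nil => simp [supportPairing_singleton_zero_right]
  | cons w l ih =>
    rw [zonotope_cons, supportPairing_add_right hKc hK0 (isCompact_symmSegment v)
      (isCompact_symmSegment w) ⟨0, zero_mem_symmSegment w⟩ (isCompact_zonotope l)
      ⟨0, zero_mem_zonotope l⟩, List.map_cons, List.map_cons, List.sum_cons, List.sum_cons, mul_add,
      add_div]
    linarith [hyp.add_le hn hKc hK hK0 v w]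

theorem UnitPairInequality.two_mul_pairRate_add_le (l : List (Rn n)) :
    2 * pairRate K l + supportPairing K (zonotope l) (zonotope l) ≤
      (l.map (segmentRate K)).sum ^ 2 / volume.real K := by
  induction l with
  | nil => simp [pairRate, supportPairing_singleton_zero_right]
  | cons v l ih =>
    set Z := zonotope l
    have hadd (A : Set (Rn n)) (hA : IsCompact A) : supportPairing K A (symmSegment v + Z) =
        supportPairing K A (symmSegment v) + supportPairing K A Z :=
      supportPairing_add_right hKc hK0 hA (isCompact_symmSegment v) ⟨0, zero_mem_symmSegment v⟩
        (isCompact_zonotope l) ⟨0, zero_mem_zonotope l⟩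
    have hexpand : supportPairing K (symmSegment v + Z) (symmSegment v + Z) =
        supportPairing K (symmSegment v) (symmSegment v) +
          2 * supportPairing K (symmSegment v) Z + supportPairing K Z Z := by
      rw [hadd _ ((isCompact_symmSegment v).add (isCompact_zonotope l)), supportPairing_comm K _ Z,
        supportPairing_comm K _ (symmSegment v), hadd _ (isCompact_symmSegment v),
        hadd _ (isCompact_zonotope l), supportPairing_comm K Z (symmSegment v)]
      ring
    have hsq (a b : ℝ) : (a + b) ^ 2 / volume.real K =
        a * a / volume.real K + 2 * (a * b / volume.real K) + b ^ 2 / volume.real K := by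
      ring
    rw [zonotope_cons, hexpand, pairRate, List.map_cons, List.sum_cons, hsq]
    linarith [hyp.supportPairing_le hn hKc hK hK0 v v,
      hyp.sum_segmentRate₂_add_le hn hKc hK hK0 v l]

theorem UnitPairInequality.mixedVol_zonotope_le (l : List (Rn n)) :
    n * (n - 1) * mixedVol 2 K (zonotope l) + supportPairing K (zonotope l) (zonotope l) ≤
      n ^ 2 * mixedVol 1 K (zonotope l) ^ 2 / volume.real K := by
  rw [mul_mixedVol_two_zonotope hKc hK hn, ← mul_pow,
    mul_mixedVol_one_zonotope hKc hK (one_le_two.trans hn)]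
  exact hyp.two_mul_pairRate_add_le hn hKc hK hK0 l

end

theorem IsSymmConvexBody.zero_mem_interior (hK : IsSymmConvexBody K) : 0 ∈ interior K := by
  obtain ⟨x, hx⟩ := hK.interior_nonempty
  simpa only [smul_neg, add_neg_cancel] using
    hK.convex.combo_interior_self_mem_interior hx (hK.symm x (interior_subset hx))
      one_half_pos one_half_pos.le (add_halves 1)

end ZonoidInequality

theorem mainTheorem6_general {n : ℕ} (hn : 2 ≤ n) {K : Set (Rn n)} (hK : Convex ℝ K)
    (hKc : IsCompact K) (hK0 : 0 ∈ interior K) (hyp : UnitPairInequality K)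
    {M : Set (Rn n)} (hM : IsZonoid M) :
    n * (n - 1) * mixedVol 2 K M + ∫ u, supportFn M u ^ 2 / supportFn K u ∂(surfaceAreaMeasure K)
      ≤ n ^ 2 * mixedVol 1 K M ^ 2 / volume.real K := by
  obtain ⟨l, hl⟩ := hM.exists_tendsto_zonotope
  have hlc (i) : IsCompact (zonotope (l i)) := isCompact_zonotope (l i)
  have hl0 (i) : (zonotope (l i)).Nonempty := ⟨0, zero_mem_zonotope (l i)⟩
  have hV (k) := hM.tendsto_mixedVol hKc hK hK0 hl k
  rw [← supportPairing_self]
  exact le_of_tendsto_of_tendsto'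
    (((hV 2).const_mul _).add
      (tendsto_supportPairing hKc hK0 hlc hl0 hM.1 hM.2.1 hlc hl0 hM.1 hM.2.1 hl hl))
    ((((hV 1).pow 2).const_mul _).div_const _)
    fun i => hyp.mixedVol_zonotope_le hn hKc hK hK0 (l i)

end LocalLogBM

theorem mainTheorem6 (n : ℕ) (hn : 2 ≤ n) (K : Set (LocalLogBM.Rn n))
    (hK : LocalLogBM.IsSymmConvexBody K)
    (hyp : ∀ v w : LocalLogBM.Rn n, ‖v‖ = 1 → ‖w‖ = 1 → LinearIndependent ℝ ![v, w] →
      4 * √(1 - ⟪v, w⟫_ℝ ^ 2) * LocalLogBM.projVol (n - 2) K (Submodule.span ℝ {v, w})ᗮ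
        + ∫ u, |⟪u, v⟫_ℝ| * |⟪u, w⟫_ℝ| / LocalLogBM.supportFn K u
            ∂(LocalLogBM.surfaceAreaMeasure K)
      ≤ 4 * LocalLogBM.projVol (n - 1) K (Submodule.span ℝ {v})ᗮ
          * LocalLogBM.projVol (n - 1) K (Submodule.span ℝ {w})ᗮ / volume.real K)
    (M : Set (LocalLogBM.Rn n)) (hM : LocalLogBM.IsZonoid M) :
    (n : ℝ) * ((n : ℝ) - 1) * LocalLogBM.mixedVol 2 K M
        + ∫ u, LocalLogBM.supportFn M u ^ 2 / LocalLogBM.supportFn K u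
            ∂(LocalLogBM.surfaceAreaMeasure K)
      ≤ (n : ℝ) ^ 2 * LocalLogBM.mixedVol 1 K M ^ 2 / volume.real K :=
  LocalLogBM.mainTheorem6_general hn hK.convex hK.isCompact hK.zero_mem_interior hyp hM
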